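/- Let $n\ge 0$ and let $\mathbb{K}$ be $\mathbb{C}$ or $\mathbb{Q}$. Let $\mathbb{K}\{x_1,\ldots,x_n\}\subset \mathbb{K}[\![x_1,\ldots,x_n]\!]$ be the ring of convergent power series, i.e. of those formal power series $\sum_m a_m x^m$ with coefficients in $\mathbb{K}$ for which $\sum_m |a_m|\, r^{|m|}<\infty$ for some real $r>0$ (here $|a_m|$ is the usual absolute value, and $|m|=m_1+\cdots+m_n$). Fix an algebraic closure $\overline{\operatorname{Frac}\mathbb{K}[\![x_1,\ldots,x_n]\!]}$ of the fraction field of $\mathbb{K}[\![x_1,\ldots,x_n]\!]$, and let $\overline{\mathbb{K}\{x_1,\ldots,x_n\}}$ be the set of its elements that are algebraic over $\mathbb{K}\{x_1,\ldots,x_n\}$, i.e. that are roots of a nonzero (not necessarily monic) polynomial with coefficients in $\mathbb{K}\{x_1,\ldots,x_n\}$. Then, inside $\overline{\operatorname{Frac}\mathbb{K}[\![x_1,\ldots,x_n]\!]}$: 1. $\overline{\mathbb{C}\{x_1,\ldots,x_n\}}\cap \mathbb{C}[\![x_1,\ldots,x_n]\!]=\mathbb{C}\{x_1,\ldots,x_n\}$;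 2. $\overline{\mathbb{Q}\{x_1,\ldots,x_n\}}\cap \mathbb{Q}[\![x_1,\ldots,x_n]\!]=\mathbb{Q}\{x_1,\ldots,x_n\}$. -/

import Mathlib

/-- A formal power series `f` in the variables `x₁, …, xₙ` over a normed field is convergent if it
converges absolutely on some polydisc of positive radius about the origin. For `𝕜 = ℂ` and for
`𝕜 = ℚ` (with its usual absolute value) this says that `f` converges on a neighbourhood of the
origin of `ℂⁿ`. -/
def MvPowerSeries.IsConvergent {n : ℕ} {𝕜 : Type*} [NormedField 𝕜]
    (f : MvPowerSeries (Fin n) 𝕜) : Prop :=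
  ∃ r : ℝ, 0 < r ∧ Summable fun m : Fin n →₀ ℕ => ‖MvPowerSeries.coeff m f‖ * r ^ m.degree

theorem MvPowerSeries.isConvergent_C {n : ℕ} {𝕜 : Type*} [NormedField 𝕜] (a : 𝕜) :
    (MvPowerSeries.C (σ := Fin n) a).IsConvergent := by
  classical
  refine ⟨1, one_pos, summable_of_ne_finset_zero (s := {0}) fun m hm => ?_⟩
  rw [MvPowerSeries.coeff_C, if_neg (by simpa using hm)]
  simp

theorem MvPowerSeries.IsConvergent.exists_common {n : ℕ} {𝕜 : Type*} [NormedField 𝕜]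
    {f g : MvPowerSeries (Fin n) 𝕜} (hf : f.IsConvergent) (hg : g.IsConvergent) :
    ∃ r : ℝ, 0 < r ∧
      (Summable fun m : Fin n →₀ ℕ => ‖MvPowerSeries.coeff m f‖ * r ^ m.degree) ∧
      Summable fun m : Fin n →₀ ℕ => ‖MvPowerSeries.coeff m g‖ * r ^ m.degree := by
  obtain ⟨r, hr, hrf⟩ := hf
  obtain ⟨s, hs, hsg⟩ := hg
  refine ⟨min r s, lt_min hr hs, ?_, ?_⟩
  · refine Summable.of_nonneg_of_le (fun m => by positivity) (fun m => ?_) hrf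
    gcongr
    exact min_le_left r s
  · refine Summable.of_nonneg_of_le (fun m => by positivity) (fun m => ?_) hsg
    gcongr
    exact min_le_right r s

theorem MvPowerSeries.IsConvergent.add {n : ℕ} {𝕜 : Type*} [NormedField 𝕜]
    {f g : MvPowerSeries (Fin n) 𝕜} (hf : f.IsConvergent) (hg : g.IsConvergent) :
    (f + g).IsConvergent := by
  obtain ⟨r, hr, hrf, hrg⟩ := hf.exists_common hg
  refine ⟨r, hr, Summable.of_nonneg_of_le (fun m => by positivity) (fun m => ?_) (hrf.add hrg)⟩
  rw [← add_mul, map_add]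
  gcongr
  exact norm_add_le _ _

theorem MvPowerSeries.IsConvergent.mul {n : ℕ} {𝕜 : Type*} [NormedField 𝕜]
    {f g : MvPowerSeries (Fin n) 𝕜} (hf : f.IsConvergent) (hg : g.IsConvergent) :
    (f * g).IsConvergent := by
  classical
  obtain ⟨r, hr, hrf, hrg⟩ := hf.exists_common hg
  have hprod := summable_sum_mul_antidiagonal_of_summable_mul
    (A := Fin n →₀ ℕ)
    (f := fun m => ‖MvPowerSeries.coeff m f‖ * r ^ m.degree)
    (g := fun m => ‖MvPowerSeries.coeff m g‖ * r ^ m.degree)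
    (hrf.mul_of_nonneg hrg (fun m => by positivity) (fun m => by positivity))
  refine ⟨r, hr, Summable.of_nonneg_of_le (fun m => by positivity) (fun m => ?_) hprod⟩
  rw [MvPowerSeries.coeff_mul]
  refine (mul_le_mul_of_nonneg_right (norm_sum_le _ _) (by positivity)).trans (le_of_eq ?_)
  rw [Finset.sum_mul]
  refine Finset.sum_congr rfl fun p hp => ?_
  rw [norm_mul, ← Finset.HasAntidiagonal.mem_antidiagonal.mp hp, map_add, pow_add]
  ring

/-- The ring `𝕜{x₁, …, xₙ}` of convergent power series, as a subalgebra of `𝕜⟦x₁, …, xₙ⟧`. -/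
def convergentPowerSeries (n : ℕ) (𝕜 : Type*) [NormedField 𝕜] :
    Subalgebra 𝕜 (MvPowerSeries (Fin n) 𝕜) where
  carrier := {f | f.IsConvergent}
  mul_mem' := fun hf hg => hf.mul hg
  add_mem' := fun hf hg => hf.add hg
  algebraMap_mem' := fun a => MvPowerSeries.isConvergent_C a

instance isDomain_mvPowerSeries (n : ℕ) (𝕜 : Type*) [NormedField 𝕜] :
    IsDomain (MvPowerSeries (Fin n) 𝕜) :=
  NoZeroDivisors.to_isDomain _

instance isDomain_convergentPowerSeries (n : ℕ) (𝕜 : Type*) [NormedField 𝕜] :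
    IsDomain (convergentPowerSeries n 𝕜) :=
  inferInstance

/-- The algebraically closed field that contains everything: an algebraic closure of the field of
fractions of `𝕜⟦x₁, …, xₙ⟧`. -/
abbrev AlgClosureFracPowerSeries (n : ℕ) (𝕜 : Type*) [NormedField 𝕜] : Type _ :=
  AlgebraicClosure (FractionRing (MvPowerSeries (Fin n) 𝕜))

/-- The image of `𝕜⟦x₁, …, xₙ⟧` in the algebraic closure of its field of fractions. -/
noncomputable def powerSeriesInClosure (n : ℕ) (𝕜 : Type*) [NormedField 𝕜] :
    Subring (AlgClosureFracPowerSeries n 𝕜) :=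
  (algebraMap (MvPowerSeries (Fin n) 𝕜) (AlgClosureFracPowerSeries n 𝕜)).range

/-- The image of `𝕜{x₁, …, xₙ}` in the algebraic closure of the fraction field of
`𝕜⟦x₁, …, xₙ⟧`. -/
noncomputable def convergentInClosure (n : ℕ) (𝕜 : Type*) [NormedField 𝕜] :
    Subring (AlgClosureFracPowerSeries n 𝕜) :=
  (algebraMap (convergentPowerSeries n 𝕜) (AlgClosureFracPowerSeries n 𝕜)).range

/-- The algebraic closure of `𝕜{x₁, …, xₙ}` in the algebraic closure of the fraction field of
`𝕜⟦x₁, …, xₙ⟧`: the elements that are a root of a nonzero polynomial, not necessarily monic,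
with coefficients in `𝕜{x₁, …, xₙ}`. -/
noncomputable def algClosureOfConvergent (n : ℕ) (𝕜 : Type*) [NormedField 𝕜] :
    Subring (AlgClosureFracPowerSeries n 𝕜) :=
  (Subalgebra.algebraicClosure (convergentPowerSeries n 𝕜)
    (AlgClosureFracPowerSeries n 𝕜)).toSubring

/-!
The substance of both equalities is that a formal power series `f` over `K = ℂ` or `ℚ` which is
algebraic over the convergent series is itself convergent. Coefficients may be taken in `ℂ`, since
the inclusion of `K` preserves absolute values.

In one variable (`PowerSeries.mem_convergent_of_isAlgebraic`), a polynomial `P ≠ 0` of least degree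
with `P(f) = 0` satisfies `P'(f) ≠ 0`, of order `e` say. Writing `f = f₀ + t ^ (e + 1) u` with `f₀`
a polynomial and expanding `P` at `f₀`, one can divide by `t ^ (2e + 1)` and is left with an
equation `u = g + t Q(u)`, where `g` and the coefficients of `Q` are convergent. This determines
the coefficients of `u` recursively, and weighted `ℓ¹`-norms of the truncations of `u` are bounded
by induction (`PowerSeries.mem_convergent_of_eq_add_X_mul`).

In several variables, `f` is restricted to the lines `t ↦ t v`. Outside a hypersurface of
directions `v` the restriction stays algebraic over `ℂ{t}`, hence converges. If `f_k` is the
homogeneous part of degree `k` of `f`, this means that `|f_k(v)| ≤ M ^ (k + 1)` for some `M`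
depending on `v`. By Baire's theorem the same `M` serves a whole polydisc of directions; the
maximum principle and homogeneity move it to the origin
(`MvPolynomial.IsHomogeneous.norm_eval_le`), and Cauchy's estimates bound the coefficients of `f`
(`MvPowerSeries.isConvergent_of_restrictLine_mem`).
-/

/-! ### Algebraic power series in one variable -/

namespace PowerSeries

section OneVariable

variable {K : Type*} [NormedField K]

/-- The weighted `ℓ¹`-norm `∑_{k < N} ‖p_k‖ r ^ k` of the truncation of a power series at order
`N`. -/
noncomputable def truncNorm (r : ℝ) (N : ℕ) (p : K⟦X⟧) : ℝ :=
  ∑ k ∈ Finset.range N, ‖coeff k p‖ * r ^ k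

theorem truncNorm_nonneg {r : ℝ} (hr : 0 ≤ r) (N : ℕ) (p : K⟦X⟧) : 0 ≤ truncNorm r N p :=
  Finset.sum_nonneg fun _ _ => by positivity

theorem truncNorm_add_le {r : ℝ} (hr : 0 ≤ r) (N : ℕ) (p q : K⟦X⟧) :
    truncNorm r N (p + q) ≤ truncNorm r N p + truncNorm r N q := by
  rw [truncNorm, truncNorm, truncNorm, ← Finset.sum_add_distrib]
  refine Finset.sum_le_sum fun k _ => ?_
  rw [← add_mul, map_add]
  gcongr
  exact norm_add_le _ _

theorem truncNorm_mul_le {r : ℝ} (hr : 0 ≤ r) (N : ℕ) (p q : K⟦X⟧) :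
    truncNorm r N (p * q) ≤ truncNorm r N p * truncNorm r N q := by
  classical
  have h1 : truncNorm r N (p * q) ≤ ∑ k ∈ Finset.range N,
      ∑ x ∈ Finset.HasAntidiagonal.antidiagonal k, (‖coeff x.1 p‖ * r ^ x.1) * (‖coeff x.2 q‖ * r ^ x.2) := by
    refine Finset.sum_le_sum fun k _ => ?_
    rw [coeff_mul]
    refine (mul_le_mul_of_nonneg_right (norm_sum_le _ _) (by positivity)).trans (le_of_eq ?_)
    rw [Finset.sum_mul]
    refine Finset.sum_congr rfl fun x hx => ?_
    rw [norm_mul, ← Finset.HasAntidiagonal.mem_antidiagonal.mp hx, pow_add]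
    ring
  refine h1.trans ?_
  rw [truncNorm, truncNorm, Finset.sum_mul_sum, ← Finset.sum_product', Finset.sum_sigma']
  rw [← Finset.sum_image
    (s := (Finset.range N).sigma fun k => Finset.HasAntidiagonal.antidiagonal k) (g := fun x => x.2)
    (f := fun x : ℕ × ℕ => (‖coeff x.1 p‖ * r ^ x.1) * (‖coeff x.2 q‖ * r ^ x.2))]
  · refine Finset.sum_le_sum_of_subset_of_nonneg ?_ fun _ _ _ => by positivity
    intro x hx
    simp only [Finset.mem_image, Finset.mem_sigma, Finset.mem_range,
      Finset.HasAntidiagonal.mem_antidiagonal, Finset.mem_product] at hx ⊢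
    obtain ⟨y, ⟨h1, h2⟩, rfl⟩ := hx
    omega
  · rintro ⟨a, x⟩ hx ⟨b, y⟩ hy (rfl : x = y)
    simp only [Finset.coe_sigma, Set.mem_sigma_iff, Finset.mem_coe,
      Finset.HasAntidiagonal.mem_antidiagonal] at hx hy
    obtain rfl : a = b := hx.2.symm.trans hy.2
    rfl

theorem truncNorm_C_le {r : ℝ} (N : ℕ) (a : K) : truncNorm r N (C a) ≤ ‖a‖ := by
  simp only [truncNorm, coeff_C]
  refine (Finset.sum_le_sum (g := fun k => if k = 0 then ‖a‖ else 0) fun k _ => ?_).trans ?_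
  · split_ifs with h <;> simp [h]
  · rw [Finset.sum_ite_eq']
    split_ifs <;> simp

theorem truncNorm_pow_le {r : ℝ} (hr : 0 ≤ r) (N : ℕ) (p : K⟦X⟧) (j : ℕ) :
    truncNorm r N (p ^ j) ≤ truncNorm r N p ^ j := by
  induction j with
  | zero => simpa using truncNorm_C_le (r := r) N (1 : K)
  | succ j ih =>
    rw [pow_succ, pow_succ]
    exact (truncNorm_mul_le hr N _ _).trans
      (mul_le_mul_of_nonneg_right ih (truncNorm_nonneg hr _ _))

theorem truncNorm_sum_le {ι : Type*} {r : ℝ} (hr : 0 ≤ r) (N : ℕ) (s : Finset ι) (p : ι → K⟦X⟧) :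
    truncNorm r N (∑ i ∈ s, p i) ≤ ∑ i ∈ s, truncNorm r N (p i) :=
  Finset.le_sum_of_subadditive _ (by simp [truncNorm]) (truncNorm_add_le hr N) s p

theorem truncNorm_succ_X_mul (r : ℝ) (N : ℕ) (p : K⟦X⟧) :
    truncNorm r (N + 1) (X * p) = r * truncNorm r N p := by
  rw [truncNorm, Finset.sum_range_succ', truncNorm, Finset.mul_sum]
  simp only [coeff_succ_X_mul, coeff_zero_X_mul, norm_zero, zero_mul, add_zero]
  exact Finset.sum_congr rfl fun k _ => by ring

theorem truncNorm_mono_radius {r s : ℝ} (hr : 0 ≤ r) (h : r ≤ s) (N : ℕ) (p : K⟦X⟧) :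
    truncNorm r N p ≤ truncNorm s N p :=
  Finset.sum_le_sum fun _ _ => by gcongr

theorem truncNorm_le_succ {r : ℝ} (hr : 0 ≤ r) (N : ℕ) (p : K⟦X⟧) :
    truncNorm r N p ≤ truncNorm r (N + 1) p := by
  rw [truncNorm, truncNorm, Finset.sum_range_succ]
  exact le_add_of_nonneg_right (by positivity)

/-- The ring `K{t}` of convergent power series in one variable: those whose weighted `ℓ¹`-norm
is finite for some positive radius. -/
def convergent (K : Type*) [NormedField K] : Subring K⟦X⟧ where
  carrier := {p | ∃ r > 0, ∃ B, ∀ N, truncNorm r N p ≤ B}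
  zero_mem' := ⟨1, one_pos, 0, fun N => by simp [truncNorm]⟩
  one_mem' := ⟨1, one_pos, 1, fun N => by simpa using truncNorm_C_le (r := 1) N (1 : K)⟩
  neg_mem' := by
    rintro p ⟨r, hr, B, h⟩
    exact ⟨r, hr, B, fun N => by simpa [truncNorm] using h N⟩
  add_mem' := by
    rintro p q ⟨r, hr, B, h⟩ ⟨s, hs, D, h'⟩
    have hm : 0 < min r s := lt_min hr hs
    exact ⟨min r s, hm, B + D, fun N => (truncNorm_add_le hm.le N p q).trans (add_le_add
      ((truncNorm_mono_radius hm.le (min_le_left _ _) N p).trans (h N))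
      ((truncNorm_mono_radius hm.le (min_le_right _ _) N q).trans (h' N)))⟩
  mul_mem' := by
    rintro p q ⟨r, hr, B, h⟩ ⟨s, hs, D, h'⟩
    have hm : 0 < min r s := lt_min hr hs
    exact ⟨min r s, hm, B * D, fun N => (truncNorm_mul_le hm.le N p q).trans (mul_le_mul
      ((truncNorm_mono_radius hm.le (min_le_left _ _) N p).trans (h N))
      ((truncNorm_mono_radius hm.le (min_le_right _ _) N q).trans (h' N))
      (truncNorm_nonneg hm.le _ _) (le_trans (by simp [truncNorm]) (h 0)))⟩

theorem mem_convergent {p : K⟦X⟧} :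
    p ∈ convergent K ↔ ∃ r > 0, ∃ B, ∀ N, truncNorm r N p ≤ B := Iff.rfl

theorem C_mem_convergent (a : K) : C a ∈ convergent K :=
  ⟨1, one_pos, ‖a‖, fun N => truncNorm_C_le N a⟩

theorem mem_convergent_of_X_mul_mem {p : K⟦X⟧} (h : X * p ∈ convergent K) :
    p ∈ convergent K := by
  obtain ⟨r, hr, B, h⟩ := h
  refine ⟨r, hr, B / r, fun N => ?_⟩
  rw [le_div_iff₀' hr, ← truncNorm_succ_X_mul]
  exact h _

theorem mem_convergent_of_X_pow_mul_mem (k : ℕ) {p : K⟦X⟧} (h : X ^ k * p ∈ convergent K) :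
    p ∈ convergent K := by
  induction k with
  | zero => simpa using h
  | succ k ih => exact ih (mem_convergent_of_X_mul_mem (by rwa [pow_succ', mul_assoc] at h))

theorem X_mem_convergent : (X : K⟦X⟧) ∈ convergent K := by
  refine ⟨1, one_pos, 1, fun N => ?_⟩
  refine (truncNorm_le_succ zero_le_one N _).trans ?_
  have := truncNorm_succ_X_mul 1 N (1 : K⟦X⟧)
  rw [mul_one] at this
  rw [this, one_mul]
  simpa using truncNorm_C_le (r := 1) N (1 : K)

theorem coe_polynomial_mem_convergent (p : Polynomial K) : (p : K⟦X⟧) ∈ convergent K := by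
  induction p using Polynomial.induction_on' with
  | add p q hp hq => simpa using add_mem hp hq
  | monomial n a =>
    rw [Polynomial.coe_monomial, monomial_eq_C_mul_X_pow]
    exact mul_mem (C_mem_convergent a) (pow_mem X_mem_convergent n)

/-- The contraction step: each coefficient of `u` is determined by the earlier ones, and the
weighted norms of the truncations of `u` stay below `‖g‖ + 1` once the radius is small. -/
theorem mem_convergent_of_eq_add_X_mul {g u : K⟦X⟧} (hg : g ∈ convergent K)
    (Q : Polynomial (convergent K)) (h : u = g + X * Polynomial.aeval u Q) :
    u ∈ convergent K := by
  obtain ⟨s, hs, A, hA⟩ := hg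
  have hA0 : 0 ≤ A := le_trans (by simp [truncNorm]) (hA 0)
  choose t ht B hB using fun j => mem_convergent.mp (Q.coeff j).2
  have hB0 : ∀ j, 0 ≤ B j := fun j => le_trans (by simp [truncNorm]) (hB j 0)
  set D : ℝ := ∑ j ∈ Finset.range (Q.natDegree + 1), B j * (A + 1) ^ j with hD
  have hD0 : 0 ≤ D := Finset.sum_nonneg fun j _ => mul_nonneg (hB0 j) (by positivity)
  obtain ⟨τ, hτ, hτt⟩ : ∃ τ > 0, ∀ j ∈ Finset.range (Q.natDegree + 1), τ ≤ t j :=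
    ⟨(Finset.range (Q.natDegree + 1)).inf' (by simp) t,
      (Finset.lt_inf'_iff _).mpr fun j _ => ht j, fun j hj => Finset.inf'_le _ hj⟩
  obtain ⟨r, hr, hrs, hrτ, hrD⟩ : ∃ r > 0, r ≤ s ∧ r ≤ τ ∧ r * D ≤ 1 := by
    refine ⟨min (min s τ) (1 / (D + 1)), by positivity, (min_le_left _ _).trans (min_le_left _ _),
      (min_le_left _ _).trans (min_le_right _ _), ?_⟩
    calc _ ≤ 1 / (D + 1) * D := by gcongr; exact min_le_right _ _
      _ ≤ 1 := by rw [one_div_mul_eq_div, div_le_one (by positivity)]; linarith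
  refine ⟨r, hr, A + 1, fun N => ?_⟩
  induction N with
  | zero => simp only [truncNorm, Finset.range_zero, Finset.sum_empty]; positivity
  | succ N ih =>
    rw [h]
    refine (truncNorm_add_le hr.le _ _ _).trans (add_le_add
      ((truncNorm_mono_radius hr.le hrs _ _).trans (hA _)) ?_)
    rw [truncNorm_succ_X_mul, Polynomial.aeval_eq_sum_range]
    refine le_trans (mul_le_mul_of_nonneg_left ?_ hr.le) hrD
    refine (truncNorm_sum_le hr.le _ _ _).trans (Finset.sum_le_sum fun j hj => ?_)
    rw [Subring.smul_def, smul_eq_mul]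
    refine (truncNorm_mul_le hr.le _ _ _).trans (mul_le_mul
      ((truncNorm_mono_radius hr.le (hrτ.trans (hτt j hj)) _ _).trans (hB j N)) ?_
      (truncNorm_nonneg hr.le _ _) (hB0 j))
    exact (truncNorm_pow_le hr.le _ _ _).trans
      (pow_le_pow_left₀ (truncNorm_nonneg hr.le _ _) ih j)

/-- A simple root: writing `f = f₀ + X ^ (e + 1) * u` with `f₀` a truncation of `f` and `e` the
order of `P'(f)`, Taylor expansion of `P` at `f₀` and division by `X ^ (2 * e + 1)` turns
`P(f) = 0` into an equation for `u` that can be solved by contraction. -/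
theorem mem_convergent_of_aeval_derivative_ne_zero {f : K⟦X⟧} {P : Polynomial (convergent K)}
    (hP : Polynomial.aeval f P = 0) (hP' : Polynomial.aeval f (Polynomial.derivative P) ≠ 0) :
    f ∈ convergent K := by
  set e := (Polynomial.aeval f (Polynomial.derivative P)).order.toNat with he
  obtain ⟨w, hw⟩ : ∃ w, Polynomial.aeval f (Polynomial.derivative P) = X ^ e * w := X_pow_order_dvd
  have hw0 : constantCoeff w ≠ 0 := by
    have := coeff_order hP'
    rw [← he, hw] at this
    simpa [coeff_X_pow_mul'] using this
  set f₀ : convergent K := ⟨(trunc (e + 1) f : Polynomial K), coe_polynomial_mem_convergent _⟩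
  set x : convergent K := ⟨X, X_mem_convergent⟩
  obtain ⟨u, hu⟩ : ∃ u, f = X ^ (e + 1) * u + (f₀ : K⟦X⟧) := 
    ⟨PowerSeries.mk fun i => coeff (i + (e + 1)) f, eq_X_pow_mul_shift_add_trunc (e + 1) f⟩
  obtain ⟨T, hT⟩ : ∃ T, T = P.comp (Polynomial.X + Polynomial.C f₀) := ⟨_, rfl⟩
  set R := T.divX.divX
  set y : K⟦X⟧ := X ^ (e + 1) * u with hy
  have hTR : T = Polynomial.C (T.coeff 0) + Polynomial.C (T.coeff 1) * Polynomial.X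
      + R * Polynomial.X ^ 2 := by
    conv_lhs => rw [← Polynomial.divX_mul_X_add T, ← Polynomial.divX_mul_X_add T.divX]
    rw [Polynomial.coeff_divX]
    ring
  have halg (a : convergent K) : algebraMap (convergent K) K⟦X⟧ a = a := rfl
  have hT0 : (T.coeff 0 : K⟦X⟧) + T.coeff 1 * y + Polynomial.aeval y R * y ^ 2 = 0 := by
    have h : Polynomial.aeval y T = 0 := by
      rw [hT, Polynomial.aeval_comp, map_add, Polynomial.aeval_X, Polynomial.aeval_C, halg, ← hu,
        hP]
    rw [hTR] at h
    simpa only [map_add, map_mul, map_pow, Polynomial.aeval_X, Polynomial.aeval_C, halg] using h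
  have hT1 : (T.coeff 1 : K⟦X⟧) + (Polynomial.aeval y (Polynomial.derivative R) * y ^ 2
      + Polynomial.aeval y R * (2 * y)) = X ^ e * w := by
    have h : Polynomial.aeval y (Polynomial.derivative T) = X ^ e * w := by
      rw [hT, Polynomial.derivative_comp, map_mul, Polynomial.aeval_comp,
        map_add (Polynomial.aeval y), Polynomial.aeval_X, Polynomial.aeval_C, halg, ← hu, hw]
      simp
    rw [hTR] at h
    simp only [map_add, map_mul, map_pow, Polynomial.aeval_X, Polynomial.aeval_C, halg,
      Polynomial.derivative_X, Polynomial.derivative_C, map_one, map_zero,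
      Polynomial.derivative_mul, Polynomial.derivative_X_sq, map_ofNat] at h
    linear_combination h
  -- since `f - f₀` is divisible by `X ^ (e + 1)`, the linear coefficient of `T` has
  -- the same order as `P'(f)`
  obtain ⟨w₀, hw₀, hw₀0⟩ : ∃ w₀ : K⟦X⟧, (T.coeff 1 : K⟦X⟧) = X ^ e * w₀ ∧
      constantCoeff w₀ ≠ 0 := by
    refine ⟨w - X * (u * (Polynomial.aeval y (Polynomial.derivative R) * y
      + Polynomial.aeval y R * 2)), ?_, by simpa using hw0⟩
    rw [eq_sub_of_add_eq hT1, hy]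
    ring
  have hw₀c : w₀ ∈ convergent K := mem_convergent_of_X_pow_mul_mem e (hw₀ ▸ (T.coeff 1).2)
  obtain ⟨w₁, hw₁⟩ : ∃ w₁ : K⟦X⟧, w₀ = X * w₁ + C (constantCoeff w₀) :=
    ⟨_, eq_X_mul_shift_add_const w₀⟩
  have hw₁c : w₁ ∈ convergent K := mem_convergent_of_X_mul_mem
    (eq_sub_of_add_eq hw₁.symm ▸ sub_mem hw₀c (C_mem_convergent _))
  set g : K⟦X⟧ := -(w₀ * u + X * (u ^ 2 * Polynomial.aeval y R)) with hg
  have hgc : g ∈ convergent K := by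
    refine mem_convergent_of_X_pow_mul_mem (2 * e + 1) ?_
    convert (T.coeff 0).2 using 1
    rw [hw₀] at hT0
    rw [hg]
    linear_combination -hT0 + (X ^ e * w₀ + Polynomial.aeval y R * (y + X ^ (e + 1) * u)) * hy
  set c : K := constantCoeff w₀
  have hcc : (C c⁻¹ * C c : K⟦X⟧) = 1 := by rw [← map_mul, inv_mul_cancel₀ hw₀0, map_one]
  have huc : u ∈ convergent K := by
    refine mem_convergent_of_eq_add_X_mul (g := C c⁻¹ * -g)
      (mul_mem (C_mem_convergent _) (neg_mem hgc))
      (Polynomial.C ⟨-C c⁻¹, neg_mem (C_mem_convergent _)⟩ *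
        (Polynomial.C ⟨w₁, hw₁c⟩ * Polynomial.X +
          Polynomial.X ^ 2 * R.comp (Polynomial.C (x ^ (e + 1)) * Polynomial.X))) ?_
    simp only [map_add, map_mul, map_pow, Polynomial.aeval_X, Polynomial.aeval_C, halg,
      Polynomial.aeval_comp]
    change u = _ + X * (-C c⁻¹ * (w₁ * u + u ^ 2 * Polynomial.aeval y R))
    rw [hg]
    linear_combination -u * hcc - C c⁻¹ * u * hw₁
  rw [hu]
  exact add_mem (mul_mem (pow_mem X_mem_convergent _) huc) f₀.2

/-- In characteristic zero `f` is a simple root of a nonzero polynomial of least degree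
among those vanishing at it. -/
theorem mem_convergent_of_isAlgebraic [CharZero K] {f : K⟦X⟧}
    (hf : IsAlgebraic (convergent K) f) : f ∈ convergent K := by
  classical
  have hex : ∃ d, ∃ P : Polynomial (convergent K), P ≠ 0 ∧ Polynomial.aeval f P = 0 ∧
      P.natDegree = d := by
    obtain ⟨P, h0, h⟩ := hf
    exact ⟨_, P, h0, h, rfl⟩
  obtain ⟨P, h0, hP, hd⟩ := Nat.find_spec hex
  refine mem_convergent_of_aeval_derivative_ne_zero hP fun h' => ?_
  have hdeg : P.natDegree ≠ 0 := by
    intro hz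
    rw [Polynomial.eq_C_of_natDegree_eq_zero hz] at hP h0
    simp only [Polynomial.aeval_C] at hP
    exact h0 (by rw [Subtype.ext (a1 := P.coeff 0) (a2 := 0) hP, Polynomial.C_0])
  have : CharZero K⟦X⟧ := charZero_of_injective_ringHom C_injective
  have : CharZero (convergent K) :=
    ⟨fun a b h => Nat.cast_injective (R := K⟦X⟧) (congrArg Subtype.val h)⟩
  refine Nat.find_min hex (m := (Polynomial.derivative P).natDegree)
    (hd ▸ Polynomial.natDegree_derivative_lt hdeg) ⟨_, fun hz => hdeg ?_, h', rfl⟩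
  exact Polynomial.derivative_eq_zero.mp hz

end OneVariable

end PowerSeries

/-! ### Cauchy's estimates and homogeneous polynomials -/

theorem Polynomial.iteratedDeriv_eval {𝕜 : Type*} [NontriviallyNormedField 𝕜] (p : Polynomial 𝕜)
    (j : ℕ) : iteratedDeriv j (fun z => p.eval z) = fun z => (derivative^[j] p).eval z := by
  induction j with
  | zero => simp
  | succ j ih =>
    rw [iteratedDeriv_succ, ih, Function.iterate_succ_apply']
    ext z
    exact Polynomial.deriv _

/-- Cauchy's estimate for the coefficients of a polynomial. -/
theorem Polynomial.norm_coeff_mul_pow_le (p : Polynomial ℂ) {ε B : ℝ} (hε : 0 < ε)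
    (h : ∀ z : ℂ, ‖z‖ = ε → ‖p.eval z‖ ≤ B) (j : ℕ) : ‖p.coeff j‖ * ε ^ j ≤ B := by
  have h1 := Complex.norm_iteratedDeriv_le_of_forall_mem_sphere_norm_le (c := 0) j hε
    (f := fun z => p.eval z) p.differentiable.diffContOnCl
    (fun z hz => h z (by simpa using hz))
  have h2 : iteratedDeriv j (fun z => p.eval z) 0 = j.factorial * p.coeff j := by
    rw [Polynomial.iteratedDeriv_eval]
    beta_reduce
    rw [← Polynomial.coeff_zero_eq_eval_zero, Polynomial.coeff_iterate_derivative]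
    simp [Nat.descFactorial_self]
  rw [h2, norm_mul, Complex.norm_natCast, mul_div_assoc] at h1
  have := le_of_mul_le_mul_left h1 (by positivity)
  rwa [le_div_iff₀ (by positivity)] at this

/-- Cauchy's estimate for the coefficients of a polynomial in several variables, by applying the
one-variable estimate in one variable at a time. -/
theorem MvPolynomial.norm_coeff_mul_pow_le {n : ℕ} (p : MvPolynomial (Fin n) ℂ) {ε B : ℝ}
    (hε : 0 < ε) (h : ∀ z : Fin n → ℂ, (∀ i, ‖z i‖ = ε) → ‖eval z p‖ ≤ B) (m : Fin n →₀ ℕ) :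
    ‖p.coeff m‖ * ε ^ m.degree ≤ B := by
  induction n generalizing B with
  | zero =>
    obtain rfl : m = 0 := Subsingleton.elim _ _
    have h0 := h Fin.elim0 (fun i => i.elim0)
    rw [p.eq_C_of_isEmpty, eval_C] at h0
    rw [map_zero, pow_zero, mul_one]
    exact h0
  | succ n ih =>
    have key := ih ((finSuccEquiv ℂ n p).coeff (m 0)) (B := B / ε ^ m 0) ?_ m.tail
    · rw [finSuccEquiv_coeff_coeff, Finsupp.cons_tail, le_div_iff₀ (by positivity), mul_assoc,
        ← pow_add] at key
      have hm : m.degree = m.tail.degree + m 0 := by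
        rw [Finsupp.degree_eq_sum, Finsupp.degree_eq_sum, Fin.sum_univ_succ, add_comm]
        rfl
      rwa [hm]
    · intro z hz
      rw [le_div_iff₀ (by positivity), ← Polynomial.coeff_map]
      refine Polynomial.norm_coeff_mul_pow_le _ hε (fun t ht => ?_) _
      rw [← eval_eq_eval_mv_eval']
      refine h _ fun i => ?_
      cases i using Fin.cases <;> simp [ht, hz]

theorem MvPolynomial.IsHomogeneous.eval_smul_eq {σ R : Type*} [CommSemiring R] {k : ℕ}
    {p : MvPolynomial σ R} (hp : p.IsHomogeneous k) (s : R) (z : σ → R) :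
    eval (s • z) p = s ^ k * eval z p := by
  rw [eval_eq, eval_eq, Finset.mul_sum]
  refine Finset.sum_congr rfl fun d hd => ?_
  have hdk : ∑ i ∈ d.support, d i = k := by
    rw [← hp (mem_support_iff.mp hd)]
    simp [Finsupp.weight_apply, Finsupp.sum]
  simp only [Pi.smul_apply, smul_eq_mul, mul_pow, Finset.prod_mul_distrib]
  rw [Finset.prod_pow_eq_pow_sum, hdk]
  ring

/-- A homogeneous polynomial bounded on a polydisc about an arbitrary centre satisfies the same
bound on the polydisc of the same radius about the origin: this is the maximum principle for
`s ↦ p(w + s v)`, which on `‖s‖ = 1` has the same modulus as `p(v + s⁻¹ w)`. -/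
theorem MvPolynomial.IsHomogeneous.norm_eval_le {n k : ℕ} {p : MvPolynomial (Fin n) ℂ}
    (hp : p.IsHomogeneous k) {ε B : ℝ} {v : Fin n → ℂ}
    (h : ∀ z, ‖z‖ ≤ ε → ‖eval (v + z) p‖ ≤ B) {w : Fin n → ℂ} (hw : ‖w‖ ≤ ε) :
    ‖eval w p‖ ≤ B := by
  set q : Polynomial ℂ := MvPolynomial.aeval
    (fun i => Polynomial.C (w i) + Polynomial.X * Polynomial.C (v i)) p with hq'
  have hq (s : ℂ) : q.eval s = eval (w + s • v) p := by
    rw [hq', ← Polynomial.coe_aeval_eq_eval, ← MvPolynomial.aeval_eq_eval]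
    refine (MvPolynomial.comp_aeval_apply _ _ p).trans ?_
    congr 2
    ext i
    simp [mul_comm s]
  have := Polynomial.norm_coeff_mul_pow_le q one_pos (B := B) (fun s hs => ?_) 0
  · rw [Polynomial.coeff_zero_eq_eval_zero, hq] at this
    simpa using this
  · have hs0 : s ≠ 0 := fun h => by simp [h] at hs
    rw [hq, show w + s • v = s • (v + s⁻¹ • w) by
      rw [smul_add, smul_inv_smul₀ hs0, add_comm]]
    rw [hp.eval_smul_eq, norm_mul, norm_pow, hs, one_pow, one_mul]
    exact h _ (by rwa [norm_smul, norm_inv, hs, inv_one, one_mul])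

theorem summable_pow_degree (n : ℕ) {q : ℝ} (h0 : 0 ≤ q) (h1 : q < 1) :
    Summable fun m : Fin n →₀ ℕ => q ^ m.degree := by
  induction n with
  | zero => exact (hasSum_fintype _).summable
  | succ n ih =>
    have := (summable_geometric_of_lt_one h0 h1).mul_of_nonneg ih
      (fun _ => by positivity) (fun _ => by positivity)
    have hinj : Function.Injective fun m : Fin (n + 1) →₀ ℕ => (m 0, m.tail) := fun a b hab => by
      obtain ⟨h, h'⟩ := Prod.ext_iff.mp hab
      rw [← a.cons_tail, ← b.cons_tail]
      exact congrArg₂ Finsupp.cons h h'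
    refine (this.comp_injective hinj).congr fun m => ?_
    rw [Function.comp_apply, ← pow_add]
    simp [Finsupp.degree_eq_sum, Fin.sum_univ_succ, Finsupp.tail_apply]

/-! ### Restriction of power series to lines -/

namespace MvPowerSeries

section Homogeneous

variable {σ R : Type*} [Fintype σ] [DecidableEq σ] [CommSemiring R]

/-- The homogeneous part of degree `k` of a power series in finitely many variables, as a
polynomial. -/
noncomputable def homogeneousPart (k : ℕ) (f : MvPowerSeries σ R) : MvPolynomial σ R :=
  ∑ m ∈ Finset.univ.finsuppAntidiag k, MvPolynomial.monomial m (coeff m f)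

theorem coeff_homogeneousPart (k : ℕ) (f : MvPowerSeries σ R) (m : σ →₀ ℕ) :
    (homogeneousPart k f).coeff m = if m.degree = k then coeff m f else 0 := by
  simp [homogeneousPart, MvPolynomial.coeff_sum, MvPolynomial.coeff_monomial,
    Finsupp.degree_eq_sum]

theorem isHomogeneous_homogeneousPart (k : ℕ) (f : MvPowerSeries σ R) :
    (homogeneousPart k f).IsHomogeneous k := by
  intro m hm
  rw [coeff_homogeneousPart] at hm
  rw [← (ite_ne_right_iff.mp hm).1]
  simp [Finsupp.weight_apply, Finsupp.degree_eq_sum, Finsupp.sum_fintype]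

theorem homogeneousPart_mul (k : ℕ) (f g : MvPowerSeries σ R) :
    homogeneousPart k (f * g) = ∑ x ∈ Finset.HasAntidiagonal.antidiagonal k,
      homogeneousPart x.1 f * homogeneousPart x.2 g := by
  ext m
  simp only [coeff_homogeneousPart, MvPolynomial.coeff_sum, MvPolynomial.coeff_mul, coeff_mul]
  rw [Finset.sum_comm]
  trans ∑ y ∈ Finset.HasAntidiagonal.antidiagonal m,
    if m.degree = k then coeff y.1 f * coeff y.2 g else 0
  · split_ifs <;> simp
  refine Finset.sum_congr rfl fun y hy => ?_
  have hm : m.degree = y.1.degree + y.2.degree := by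
    rw [← Finset.HasAntidiagonal.mem_antidiagonal.mp hy, map_add]
  rw [hm, Finset.sum_congr rfl (g := fun x => if (y.1.degree, y.2.degree) = x then
    coeff y.1 f * coeff y.2 g else 0) fun x _ => ?_, Finset.sum_ite_eq]
  · simp only [Finset.HasAntidiagonal.mem_antidiagonal]
  · simp only [ite_zero_mul_ite_zero, Prod.ext_iff]

/-- The restriction `f(t v) ∈ R⟦t⟧` of a power series `f` to the line through the origin in the
direction `v`. -/
noncomputable def restrictLine (v : σ → R) : MvPowerSeries σ R →+* PowerSeries R where
  toFun f := PowerSeries.mk fun k => MvPolynomial.eval v (homogeneousPart k f)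
  map_zero' := by ext; simp [homogeneousPart]
  map_add' f g := by ext; simp [homogeneousPart, Finset.sum_add_distrib]
  map_one' := by
    ext k
    rw [PowerSeries.coeff_mk, PowerSeries.coeff_one]
    have : homogeneousPart k (1 : MvPowerSeries σ R) = if k = 0 then 1 else 0 := by
      ext m
      rw [coeff_homogeneousPart, coeff_one]
      rcases eq_or_ne m 0 with rfl | hm
      · rcases eq_or_ne k 0 with rfl | hk
        · simp
        · simp [hk, hk.symm]
      · rcases eq_or_ne k 0 with rfl | hk
        · simp [hm, hm.symm, MvPolynomial.coeff_one]
        · simp [hm, hk]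
    rw [this]
    split_ifs <;> simp
  map_mul' f g := by
    ext k
    simp [homogeneousPart_mul, PowerSeries.coeff_mul]

theorem coeff_restrictLine (v : σ → R) (f : MvPowerSeries σ R) (k : ℕ) :
    PowerSeries.coeff k (restrictLine v f) = MvPolynomial.eval v (homogeneousPart k f) :=
  PowerSeries.coeff_mk k fun k => MvPolynomial.eval v (homogeneousPart k f)

end Homogeneous

theorem IsConvergent.restrictLine {n : ℕ} {f : MvPowerSeries (Fin n) ℂ} (hf : f.IsConvergent)
    (v : Fin n → ℂ) : f.restrictLine v ∈ PowerSeries.convergent ℂ := by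
  obtain ⟨r, hr, hs⟩ := hf
  set s := r / (‖v‖ + 1)
  have hsv : s * ‖v‖ ≤ r := by
    rw [div_mul_eq_mul_div, div_le_iff₀ (by positivity)]
    nlinarith [norm_nonneg v]
  refine ⟨s, by positivity, ∑' m, ‖coeff m f‖ * r ^ m.degree, fun N => ?_⟩
  have hpart (k : ℕ) : ‖PowerSeries.coeff k (f.restrictLine v)‖ * s ^ k ≤
      ∑ m ∈ Finset.univ.finsuppAntidiag k, ‖coeff m f‖ * r ^ m.degree := by
    rw [coeff_restrictLine, homogeneousPart, map_sum]
    refine (mul_le_mul_of_nonneg_right (norm_sum_le _ _) (by positivity)).trans ?_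
    rw [Finset.sum_mul]
    refine Finset.sum_le_sum fun m hm => ?_
    obtain rfl : m.degree = k := by
      rw [Finsupp.degree_eq_sum]
      exact (Finset.mem_finsuppAntidiag.mp hm).1
    rw [MvPolynomial.eval_monomial, norm_mul, mul_assoc]
    gcongr
    rw [Finsupp.prod_fintype _ _ (by simp), norm_prod, Finsupp.degree_eq_sum,
      ← Finset.prod_pow_eq_pow_sum, ← Finset.prod_pow_eq_pow_sum, ← Finset.prod_mul_distrib]
    refine Finset.prod_le_prod (fun _ _ => by positivity) fun i _ => ?_
    rw [norm_pow, ← mul_pow]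
    gcongr
    exact le_trans (by rw [mul_comm]; gcongr; exact norm_le_pi_norm v i) hsv
  refine (Finset.sum_le_sum fun k _ => hpart k).trans ?_
  rw [← Finset.sum_biUnion]
  · exact hs.sum_le_tsum _ fun _ _ => by positivity
  · intro a _ b _ hab
    refine Finset.disjoint_left.mpr fun m ha hb => hab ?_
    exact (Finset.mem_finsuppAntidiag.mp ha).1.symm.trans (Finset.mem_finsuppAntidiag.mp hb).1

/-! ### Convergence from convergence on lines -/

/-- A formal power series whose restrictions to the lines outside a hypersurface `h = 0` converge
is convergent. By Baire's theorem the radii of convergence are bounded below for `v` in some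
polydisc; homogeneity moves this polydisc to the origin, where Cauchy's estimates apply. -/
theorem isConvergent_of_restrictLine_mem {n : ℕ} {f : MvPowerSeries (Fin n) ℂ}
    {h : MvPolynomial (Fin n) ℂ} (h0 : h ≠ 0)
    (hf : ∀ v, MvPolynomial.eval v h ≠ 0 → f.restrictLine v ∈ PowerSeries.convergent ℂ) :
    f.IsConvergent := by
  set F := fun k => homogeneousPart k f with hF
  -- multiplying by `h` makes these sets closed and makes them cover the hypersurface too
  set A : ℕ → Set (Fin n → ℂ) := fun M =>
    {v | ∀ k, ‖MvPolynomial.eval v h‖ * ‖MvPolynomial.eval v (F k)‖ ≤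
      ‖MvPolynomial.eval v h‖ * M ^ (k + 1)} with hA
  have hclosed (M : ℕ) : IsClosed (A M) := by
    simp only [hA, Set.ofPred_forall]
    refine isClosed_iInter fun k => isClosed_le ?_ ?_
    · exact (MvPolynomial.continuous_eval h).norm.mul (MvPolynomial.continuous_eval (F k)).norm
    · exact (MvPolynomial.continuous_eval h).norm.mul continuous_const
  have hcover : ⋃ M, A M = Set.univ := by
    refine Set.eq_univ_of_forall fun v => Set.mem_iUnion.mpr ?_
    by_cases hv : MvPolynomial.eval v h = 0
    · exact ⟨0, fun k => by simp [hv]⟩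
    obtain ⟨r, hr, B, hB⟩ := hf v hv
    obtain ⟨M, hM⟩ := exists_nat_ge (max (1 / r) B)
    refine ⟨M, fun k => mul_le_mul_of_nonneg_left ?_ (norm_nonneg _)⟩
    have hk : ‖MvPolynomial.eval v (F k)‖ * r ^ k ≤ B := by
      rw [hF, ← coeff_restrictLine]
      exact (Finset.single_le_sum (f := fun k => ‖PowerSeries.coeff k (f.restrictLine v)‖ * r ^ k)
        (fun _ _ => by positivity) (Finset.self_mem_range_succ k)).trans (hB (k + 1))
    calc ‖MvPolynomial.eval v (F k)‖ = ‖MvPolynomial.eval v (F k)‖ * r ^ k * (1 / r) ^ k := by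
          rw [mul_assoc, ← mul_pow, mul_one_div_cancel hr.ne', one_pow, mul_one]
      _ ≤ M * M ^ k := by
          gcongr
          · exact hk.trans ((le_max_right _ _).trans hM)
          · exact (le_max_left _ _).trans hM
      _ = M ^ (k + 1) := (pow_succ' _ _).symm
  obtain ⟨M, hM⟩ := nonempty_interior_of_iUnion_of_closed hclosed hcover
  obtain ⟨v, hv, hvh⟩ : ∃ v ∈ interior (A M), MvPolynomial.eval v h ≠ 0 := by
    by_contra! hzero
    obtain ⟨v, hv⟩ := hM
    obtain ⟨ε, hε, hsub⟩ := Metric.isOpen_iff.mp isOpen_interior v hv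
    rw [ball_pi v hε] at hsub
    refine h0 (MvPolynomial.funext_set (fun i => Metric.ball (v i) ε)
      (fun i => infinite_of_mem_nhds (v i) (Metric.ball_mem_nhds _ hε)) fun x hx => ?_)
    rw [hzero x (hsub hx), map_zero]
  obtain ⟨ε, hε, hball⟩ : ∃ ε > 0, ∀ z, ‖z‖ ≤ ε → ∀ k,
      ‖MvPolynomial.eval (v + z) (F k)‖ ≤ (M : ℝ) ^ (k + 1) := by
    have hmem : interior (A M) ∩ {z | MvPolynomial.eval z h ≠ 0} ∈ nhds v :=
      Filter.inter_mem (isOpen_interior.mem_nhds hv)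
        ((isOpen_ne_fun (MvPolynomial.continuous_eval h) continuous_const).mem_nhds hvh)
    obtain ⟨ε, hε, hsub⟩ := Metric.nhds_basis_closedBall.mem_iff.mp hmem
    refine ⟨ε, hε, fun z hz k => ?_⟩
    obtain ⟨h1, h2⟩ := hsub (show v + z ∈ Metric.closedBall v ε by simpa using hz)
    exact le_of_mul_le_mul_left (interior_subset h1 k) (norm_pos_iff.mpr h2)
  have hcoeff (m : Fin n →₀ ℕ) : ‖coeff m f‖ * ε ^ m.degree ≤ (M : ℝ) ^ (m.degree + 1) := by
    have := (F m.degree).norm_coeff_mul_pow_le hε (B := (M : ℝ) ^ (m.degree + 1))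
      (fun z hz => (isHomogeneous_homogeneousPart _ f).norm_eval_le (fun z hz => hball z hz _)
        ((pi_norm_le_iff_of_nonneg hε.le).mpr fun i => (hz i).le)) m
    rwa [hF, coeff_homogeneousPart, if_pos rfl] at this
  set q : ℝ := M / (M + 1)
  have hq : q < 1 := by
    rw [div_lt_one (by positivity)]
    linarith
  refine ⟨ε / (M + 1), by positivity, Summable.of_nonneg_of_le (fun m => by positivity)
    (fun m => ?_) ((summable_pow_degree n (by positivity : 0 ≤ q) hq).mul_left (M : ℝ))⟩
  rw [div_pow, ← mul_div_assoc, div_pow, ← mul_div_assoc, ← pow_succ']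
  gcongr
  exact hcoeff m

end MvPowerSeries

/-! ### Algebraic power series are convergent -/

/-- If `P(f) = 0` and `h` is a nonzero homogeneous part of the leading coefficient of `P`, then on
every line on which `h` does not vanish identically the restriction of `P` is nonzero, so that the
restriction of `f` is algebraic over `ℂ{t}`. Coefficients are moved to `ℂ` because the Baire
argument and Cauchy's estimates take place there; `K → ℂ` preserves the norm. -/
theorem MvPowerSeries.isConvergent_of_isAlgebraic {n : ℕ} {K : Type*} [NormedField K]
    [NormedAlgebra K ℂ] {f : MvPowerSeries (Fin n) K}
    (hf : IsAlgebraic (convergentPowerSeries n K) f) : f.IsConvergent := by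
  obtain ⟨P, hP, hPf⟩ := hf
  have hmap (g : MvPowerSeries (Fin n) K) :
      (MvPowerSeries.map (algebraMap K ℂ) g).IsConvergent ↔ g.IsConvergent := by
    simp [IsConvergent, norm_algebraMap']
  rw [← hmap]
  set a : MvPowerSeries (Fin n) ℂ := MvPowerSeries.map (algebraMap K ℂ) P.leadingCoeff
  have ha : a ≠ 0 := by
    refine fun h => hP (Polynomial.leadingCoeff_eq_zero.mp (Subtype.ext ?_))
    ext m
    simpa [a] using congrArg (coeff m) h
  obtain ⟨k, hk⟩ : ∃ k, homogeneousPart k a ≠ 0 := by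
    obtain ⟨m, hm⟩ := MvPowerSeries.ne_zero_iff_exists_coeff_ne_zero a |>.mp ha
    refine ⟨m.degree, fun h => hm ?_⟩
    rw [← MvPolynomial.coeff_zero m, ← h, coeff_homogeneousPart, if_pos rfl]
  refine isConvergent_of_restrictLine_mem hk fun v hv => ?_
  let ρ : MvPowerSeries (Fin n) K →+* PowerSeries ℂ :=
    (restrictLine v).comp (MvPowerSeries.map (algebraMap K ℂ))
  let ρc : convergentPowerSeries n K →+* PowerSeries.convergent ℂ :=
    (ρ.comp (convergentPowerSeries n K).val.toRingHom).codRestrict _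
      fun g => ((hmap _).mpr g.2).restrictLine v
  refine PowerSeries.mem_convergent_of_isAlgebraic ⟨P.map ρc, fun h0 => hv ?_, ?_⟩
  · have := congrArg (fun q => PowerSeries.coeff k (q.coeff P.natDegree).1) h0
    simp only [Polynomial.coeff_map] at this
    rw [← coeff_restrictLine]
    exact this
  · change Polynomial.aeval (ρ f) (P.map ρc) = 0
    rw [Polynomial.aeval_def, Polynomial.eval₂_map, ← map_zero ρ, ← hPf, Polynomial.aeval_def,
      Polynomial.hom_eval₂]
    rfl

theorem inf_eq_convergentInClosure (n : ℕ) (K : Type*) [NormedField K] [NormedAlgebra K ℂ] :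
    algClosureOfConvergent n K ⊓ powerSeriesInClosure n K = convergentInClosure n K := by
  have hinj : Function.Injective
      (algebraMap (MvPowerSeries (Fin n) K) (AlgClosureFracPowerSeries n K)) := by
    rw [IsScalarTower.algebraMap_eq _ (FractionRing (MvPowerSeries (Fin n) K)), RingHom.coe_comp]
    exact (algebraMap (FractionRing (MvPowerSeries (Fin n) K)) _).injective.comp
      (IsFractionRing.injective _ _)
  ext y
  constructor
  · rintro ⟨hy, f, rfl⟩
    have hf : IsAlgebraic (convergentPowerSeries n K) f :=
      (isAlgebraic_algebraMap_iff hinj).mp hy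
    exact ⟨⟨f, MvPowerSeries.isConvergent_of_isAlgebraic hf⟩, rfl⟩
  · rintro ⟨f, rfl⟩
    exact ⟨isAlgebraic_algebraMap f, f.1, rfl⟩

theorem mainTheorem12 (n : ℕ) :
    algClosureOfConvergent n ℂ ⊓ powerSeriesInClosure n ℂ = convergentInClosure n ℂ ∧
    algClosureOfConvergent n ℚ ⊓ powerSeriesInClosure n ℚ = convergentInClosure n ℚ :=
  ⟨inf_eq_convergentInClosure n ℂ, inf_eq_convergentInClosure n ℚ⟩
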